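/- **Setting.** Let $M$ be a smooth manifold of dimension $N=m+1$ with a smooth Lorentzian metric $g$ (signature $(-,+,\dots,+)$) and a smooth affine connection $\nabla$ with $\nabla g=0$, with coefficients $\nabla_\alpha u^\gamma=\partial_\alpha u^\gamma+C^\gamma_{\alpha\beta}u^\beta$ and arbitrary torsion $S_{\alpha\beta}{}^\gamma=C^\gamma_{[\alpha\beta]}=\tfrac12(C^\gamma_{\alpha\beta}-C^\gamma_{\beta\alpha})$. The Riemann tensor is $$R_{\alpha\beta\gamma}{}^{\rho}=\partial_\beta C^\rho_{\alpha\gamma}-\partial_\alpha C^\rho_{\beta\gamma}+C^\rho_{\beta\sigma}C^\sigma_{\alpha\gamma}-C^\rho_{\alpha\sigma}C^\sigma_{\beta\gamma},\qquad R_{\alpha\beta\gamma\delta}=g_{\delta\rho}R_{\alpha\beta\gamma}{}^{\rho}.$$ Let $U\subseteq M$ be an open set foliated by hypersurfaces which are orthogonal to the integral curves of a smooth vector field $n$ on $U$ with $g(n,n)=\varepsilon\in\{1,-1\}$ constant (the curves are parametrized by arc length; $\nabla_n n$ need not vanish). Let $e_1,\dots,e_m$ be a smooth frame on $U$ of the tangent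 spaces of the leaves and $e^1,\dots,e^m$ the dual coframe, $e^a_\alpha e^\alpha_b=\delta^a_b$, $e^a_\alpha n^\alpha=0$. Put $$h_{ab}=g(e_a,e_b),\quad K_{ab}=e_a^\alpha e_b^\beta\nabla_\alpha n_\beta,\quad a^b=e^b_\mu n^\nu\nabla_\nu n^\mu,\quad \varphi^a{}_b=e^a_\alpha n^\beta\nabla_\beta e^\alpha_b,\quad C^c_{ab}=e_a^\alpha(\nabla_\alpha e_b^\beta)e^c_\beta .$$ Latin indices $1,\dots,m$ are raised and lowered with $h$, Greek indices with $g$; repeated indices are summed. On a tensor, a lower Latin index means contraction with the corresponding $e_a$, an upper one contraction with $e^a$, and a lower index $0$ contraction with $n$: $S_{abc}=e_a^\alpha e_b^\beta e_c^\gamma S_{\alpha\beta\gamma}$, $S_{0ab}=n^\mu e_a^\alpha e_b^\beta S_{\mu\alpha\beta}$, $S_{a00}=e_a^\alpha n^\mu n^\nu S_{\alpha\mu\nu}$, and so on. The dot denotes $\dot\psi_{a\dots b}=n^\mu\partial_\mu(\psi_{a\dots b})$ on components, and $D$ is the induced covariant derivative, $D_a\psi_b=e_a^\alpha\partial_\alpha\psi_b-C^d_{ab}\psi_d$,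 $D_a\psi_{bc}=e_a^\alpha\partial_\alpha\psi_{bc}-C^d_{ab}\psi_{dc}-C^d_{ac}\psi_{bd}$. Round and square brackets denote symmetrization and antisymmetrization with weights $\tfrac1{2}$ (two indices) and $\tfrac16$ (three indices); indices between vertical bars are left out. **Claim.** At every point of $U$, for all $a,b,c$, $$\begin{aligned}e_a^\alpha n^\beta e_c^\gamma n^\delta R_{\alpha\beta\gamma\delta}={}&D_aa_c-K_{ad}K^d{}_c-\dot K_{ac}-\varepsilon a_aa_c+K_{ad}\varphi^d{}_c+K_{dc}\varphi^d{}_a\\&+2n^\mu S_{a\mu}{}^dK_{dc}+2\varepsilon n^\mu n^\nu S_{a\mu\nu}a_c\end{aligned}$$ and $$\begin{aligned}\tfrac12e_a^\alpha e_b^\beta e_c^\gamma n^\delta&(R_{\gamma\delta\alpha\beta}-R_{\alpha\beta\gamma\delta})=D_aS_{0(bc)}-D_bS_{0(ac)}+D_cS_{0[ba]}-\tfrac12\dot S_{abc}+\dot S_{c[ab]}-\tfrac32D_{[a}K_{bc]}\\&-2S_{0a}{}^\mu S_{\mu(bc)}+2S_{0b}{}^\mu S_{\mu(ac)}-S_{0ia}S_{bc}{}^i-2S_{\mu[ab]}S_{c0}{}^\mu-2S_{0i(b}S_{c)a}{}^i-\tfrac32S_{[ab|}{}^iK_{i|c]}\\&+S_{i[ab]}K_c{}^i-S_{i(bc)}K_a{}^i+S_{i(ac)}K_b{}^i+\varepsilon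 S_{a00}K_{(bc)}-\varepsilon S_{[b|00}K_{|c]a}-\varepsilon K_{a(b}S_{c)00}+U_{abc},\end{aligned}$$ where, with $V^\mu_a=e^\mu_i\varphi^i{}_a-\varepsilon n^\mu a_a$, $$U_{abc}=S_{\mu(bc)}V^\mu_a+\left(S_{\mu[ba]}+\tfrac12S_{ab\mu}\right)V^\mu_c+S_{[a|c\mu}V^\mu_{|b]}-S_{\mu(ac)}V^\mu_b .$$ -/

import Mathlib

open scoped Manifold ContDiff
open Bundle

noncomputable section

/-- Differentiability of a vector field at a point. -/
def VectorFieldDiffAt {m : ℕ} {M : Type*} [TopologicalSpace M]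
    [ChartedSpace (EuclideanSpace ℝ (Fin (m + 1))) M] [IsManifold (𝓡 (m + 1)) ∞ M]
    (X : ∀ x : M, TangentSpace (𝓡 (m + 1)) x) (x : M) : Prop :=
  MDifferentiableAt (𝓡 (m + 1)) ((𝓡 (m + 1)).prod 𝓘(ℝ, EuclideanSpace ℝ (Fin (m + 1))))
    (fun y ↦ TotalSpace.mk' (EuclideanSpace ℝ (Fin (m + 1))) y (X y)) x

/-- Smoothness of a vector field on a set. -/
def VectorFieldSmoothOn {m : ℕ} {M : Type*} [TopologicalSpace M]
    [ChartedSpace (EuclideanSpace ℝ (Fin (m + 1))) M] [IsManifold (𝓡 (m + 1)) ∞ M]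
    (X : ∀ x : M, TangentSpace (𝓡 (m + 1)) x) (W : Set M) : Prop :=
  ContMDiffOn (𝓡 (m + 1)) ((𝓡 (m + 1)).prod 𝓘(ℝ, EuclideanSpace ℝ (Fin (m + 1)))) ∞
    (fun y ↦ TotalSpace.mk' (EuclideanSpace ℝ (Fin (m + 1))) y (X y)) W

/-- A smooth `(m+1)`-dimensional Lorentzian manifold (signature `(-,+,…,+)`) together with a smooth
metric-compatible affine connection, whose torsion is arbitrary. -/
structure RiemannCartan (m : ℕ) (M : Type*) [TopologicalSpace M]
    [ChartedSpace (EuclideanSpace ℝ (Fin (m + 1))) M] [IsManifold (𝓡 (m + 1)) ∞ M] where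
  /-- the metric tensor -/
  g : ∀ x : M, TangentSpace (𝓡 (m + 1)) x →L[ℝ] TangentSpace (𝓡 (m + 1)) x →L[ℝ] ℝ
  /-- the affine connection: `conn Y x (X x)` is `(∇_X Y)(x)` -/
  conn : CovariantDerivative (𝓡 (m + 1)) (EuclideanSpace ℝ (Fin (m + 1)))
    (TangentSpace (𝓡 (m + 1)) : M → Type _)
  g_symm : ∀ (x : M) (v w : TangentSpace (𝓡 (m + 1)) x), g x v w = g x w v
  g_lorentzian : ∀ x : M, ∃ t : TangentSpace (𝓡 (m + 1)) x, g x t t < 0 ∧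
    ∀ v : TangentSpace (𝓡 (m + 1)) x, g x t v = 0 → v ≠ 0 → 0 < g x v v
  g_smooth : ContMDiff (𝓡 (m + 1))
    ((𝓡 (m + 1)).prod 𝓘(ℝ, EuclideanSpace ℝ (Fin (m + 1)) →L[ℝ]
      EuclideanSpace ℝ (Fin (m + 1)) →L[ℝ] ℝ)) ∞
    (fun x ↦ TotalSpace.mk' (EuclideanSpace ℝ (Fin (m + 1)) →L[ℝ]
      EuclideanSpace ℝ (Fin (m + 1)) →L[ℝ] ℝ) x (g x))
  /-- covariant derivatives of smooth local vector fields are smooth -/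
  conn_smooth : ∀ W : Set M, IsOpen W →
    ContMDiffCovariantDerivativeOn (EuclideanSpace ℝ (Fin (m + 1))) ∞ conn.toFun W
  /-- metric compatibility: `v (g(Y,Z)) = g(∇_v Y, Z) + g(Y, ∇_v Z)` -/
  conn_metric : ∀ (x : M) (Y Z : ∀ y : M, TangentSpace (𝓡 (m + 1)) y)
    (v : TangentSpace (𝓡 (m + 1)) x), VectorFieldDiffAt Y x → VectorFieldDiffAt Z x →
    mvfderiv (𝓡 (m + 1)) (fun y ↦ g y (Y y) (Z y)) x v
      = g x (conn Y x v) (Z x) + g x (Y x) (conn Z x v)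

namespace RiemannCartan

variable {m : ℕ} {M : Type*} [TopologicalSpace M]
  [ChartedSpace (EuclideanSpace ℝ (Fin (m + 1))) M] [IsManifold (𝓡 (m + 1)) ∞ M]

/-- The covariant derivative `∇_X Y` of vector fields. -/
def nabla (G : RiemannCartan m M) (X Y : ∀ x : M, TangentSpace (𝓡 (m + 1)) x) :
    ∀ x : M, TangentSpace (𝓡 (m + 1)) x :=
  fun x ↦ G.conn Y x (X x)

/-- The torsion tensor `S_{αβ}{}^γ X^α Y^β = ½ (∇_X Y - ∇_Y X - [X, Y])^γ`, that is, the
antisymmetric part of the connection coefficients. -/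
def S (G : RiemannCartan m M) (X Y : ∀ x : M, TangentSpace (𝓡 (m + 1)) x) :
    ∀ x : M, TangentSpace (𝓡 (m + 1)) x :=
  fun x ↦ (1 / 2 : ℝ) • G.conn.torsion x (X x) (Y x)

/-- `S_{αβγ} X^α Y^β Z^γ`, with the third index lowered by the metric. -/
def S₃ (G : RiemannCartan m M) (X Y Z : ∀ x : M, TangentSpace (𝓡 (m + 1)) x) (x : M) : ℝ :=
  G.g x (G.S X Y x) (Z x)

/-- The Riemann tensor `R_{αβγ}{}^ρ X^α Y^β Z^γ`, with the sign convention
`R_{αβγ}{}^ρ = ∂_β C_{αγ}^ρ - ∂_α C_{βγ}^ρ + C_{βσ}^ρ C_{αγ}^σ - C_{ασ}^ρ C_{βγ}^σ`. -/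
def riem (G : RiemannCartan m M) (X Y Z : ∀ x : M, TangentSpace (𝓡 (m + 1)) x) :
    ∀ x : M, TangentSpace (𝓡 (m + 1)) x :=
  fun x ↦ G.nabla Y (G.nabla X Z) x - G.nabla X (G.nabla Y Z) x
    + G.nabla (VectorField.mlieBracket (𝓡 (m + 1)) X Y) Z x

/-- `R_{αβγδ} X^α Y^β Z^γ W^δ`, with the fourth index lowered by the metric. -/
def R (G : RiemannCartan m M) (X Y Z W : ∀ x : M, TangentSpace (𝓡 (m + 1)) x) (x : M) : ℝ :=
  G.g x (G.riem X Y Z x) (W x)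

end RiemannCartan

/-- An open set `U` foliated by hypersurfaces that are orthogonal to the integral curves of a unit
vector field `n`, with `g(n,n) = ε = ±1`, and a smooth frame `e_1, …, e_m` of the tangent spaces of
the leaves. The leaves are, locally, the level sets of a smooth function with nonzero
differential. -/
structure OrthogonalFoliation {m : ℕ} {M : Type*} [TopologicalSpace M]
    [ChartedSpace (EuclideanSpace ℝ (Fin (m + 1))) M] [IsManifold (𝓡 (m + 1)) ∞ M]
    (G : RiemannCartan m M) where
  U : Set M
  isOpen_U : IsOpen U
  ε : ℝ
  ε_eq : ε = 1 ∨ ε = -1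
  n : ∀ x : M, TangentSpace (𝓡 (m + 1)) x
  n_smooth : VectorFieldSmoothOn n U
  n_unit : ∀ x ∈ U, G.g x (n x) (n x) = ε
  foliated : ∀ x ∈ U, ∃ (W : Set M) (f : M → ℝ), IsOpen W ∧ x ∈ W ∧ W ⊆ U ∧ ContMDiffOn (𝓡 (m + 1)) 𝓘(ℝ, ℝ) ∞ f W ∧
    ∀ y ∈ W, mvfderiv (𝓡 (m + 1)) f y ≠ 0 ∧ ∀ v : TangentSpace (𝓡 (m + 1)) y,
      mvfderiv (𝓡 (m + 1)) f y v = 0 ↔ G.g y (n y) v = 0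
  e : Fin m → ∀ x : M, TangentSpace (𝓡 (m + 1)) x
  e_smooth : ∀ a, VectorFieldSmoothOn (e a) U
  e_linearIndependent : ∀ x ∈ U, LinearIndependent ℝ (fun a ↦ e a x)
  e_tangent : ∀ x ∈ U, ∀ a, G.g x (n x) (e a x) = 0

namespace OrthogonalFoliation

variable {m : ℕ} {M : Type*} [TopologicalSpace M]
  [ChartedSpace (EuclideanSpace ℝ (Fin (m + 1))) M] [IsManifold (𝓡 (m + 1)) ∞ M]
  {G : RiemannCartan m M}

/-- The first fundamental form `h_{ab} = g(e_a, e_b)`, as a matrix. -/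
def h (F : OrthogonalFoliation G) (x : M) : Matrix (Fin m) (Fin m) ℝ :=
  Matrix.of fun a b ↦ G.g x (F.e a x) (F.e b x)

/-- The inverse `h^{ab}` of the first fundamental form. -/
def hInv (F : OrthogonalFoliation G) (a b : Fin m) (x : M) : ℝ :=
  (F.h x)⁻¹ a b

/-- The tangential component `e^a_α X^α = h^{ab} g(e_b, X)`; here `e^a` is the dual coframe,
`e^a(e_b) = δ^a_b` and `e^a(n) = 0`. -/
def coframe (F : OrthogonalFoliation G) (a : Fin m) (X : ∀ x : M, TangentSpace (𝓡 (m + 1)) x)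
    (x : M) : ℝ :=
  ∑ b, F.hInv a b x * G.g x (F.e b x) (X x)

/-- The second fundamental form `K_{ab} = e_a^α e_b^β ∇_α n_β`. -/
def K (F : OrthogonalFoliation G) (a b : Fin m) (x : M) : ℝ :=
  G.g x (G.nabla (F.e a) F.n x) (F.e b x)

/-- The acceleration `a^b = e^b_μ n^ν ∇_ν n^μ`. -/
def accUp (F : OrthogonalFoliation G) (b : Fin m) (x : M) : ℝ :=
  F.coframe b (G.nabla F.n F.n) x

/-- The acceleration with lowered index, `a_b = h_{bc} a^c`. -/
def acc (F : OrthogonalFoliation G) (b : Fin m) (x : M) : ℝ :=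
  ∑ c, F.h x b c * F.accUp c x

/-- `φ^a{}_b = e^a_α n^β ∇_β e_b^α`. -/
def φ (F : OrthogonalFoliation G) (a b : Fin m) (x : M) : ℝ :=
  F.coframe a (G.nabla F.n (F.e b)) x

/-- The vector fields `e_i^μ φ^i{}_a - ε n^μ a_a`. -/
def V (F : OrthogonalFoliation G) (a : Fin m) : ∀ x : M, TangentSpace (𝓡 (m + 1)) x :=
  fun x ↦ (∑ i, F.φ i a x • F.e i x) - (F.ε * F.acc a x) • F.n x

/-- `S_{abc} = e_a^α e_b^β e_c^γ S_{αβγ}`. -/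
def S (F : OrthogonalFoliation G) (a b c : Fin m) (x : M) : ℝ :=
  G.S₃ (F.e a) (F.e b) (F.e c) x

/-- The induced torsion `S_{ab}{}^c = e_a^α e_b^β e^c_γ S_{αβ}{}^γ`. -/
def SUp (F : OrthogonalFoliation G) (a b c : Fin m) (x : M) : ℝ :=
  F.coframe c (G.S (F.e a) (F.e b)) x

/-- `S_{0ab} = n^μ e_a^α e_b^β S_{μαβ}`. -/
def S0 (F : OrthogonalFoliation G) (a b : Fin m) (x : M) : ℝ :=
  G.S₃ F.n (F.e a) (F.e b) x

/-- `S_{a00} = e_a^α n^μ n^ν S_{αμν}`. -/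
def S00 (F : OrthogonalFoliation G) (a : Fin m) (x : M) : ℝ :=
  G.S₃ (F.e a) F.n F.n x

/-- The induced connection `C_{ab}^c = e_a^α (∇_α e_b^β) e^c_β`. -/
def C (F : OrthogonalFoliation G) (a b c : Fin m) (x : M) : ℝ :=
  F.coframe c (G.nabla (F.e a) (F.e b)) x

/-- The intrinsic covariant derivative `D_a ψ_b` of a covector field on the leaves. -/
def D₁ (F : OrthogonalFoliation G) (ψ : Fin m → M → ℝ) (a b : Fin m) (x : M) : ℝ :=
  mvfderiv (𝓡 (m + 1)) (ψ b) x (F.e a x) - ∑ d, F.C a b d x * ψ d x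

/-- The intrinsic covariant derivative `D_a ψ_{bc}` of a twice covariant tensor on the leaves. -/
def D₂ (F : OrthogonalFoliation G) (ψ : Fin m → Fin m → M → ℝ) (a b c : Fin m) (x : M) : ℝ :=
  mvfderiv (𝓡 (m + 1)) (ψ b c) x (F.e a x)
    - ∑ d, F.C a b d x * ψ d c x - ∑ d, F.C a c d x * ψ b d x

/-- The dot of a component: `n^μ ∂_μ ψ`. -/
def dot (F : OrthogonalFoliation G) (ψ : M → ℝ) (x : M) : ℝ :=
  mvfderiv (𝓡 (m + 1)) ψ x (F.n x)

end OrthogonalFoliation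

/-- Symmetrization `ψ_{(ab)}`. -/
def sym {ι : Type*} (ψ : ι → ι → ℝ) (a b : ι) : ℝ := (ψ a b + ψ b a) / 2

/-- Antisymmetrization `ψ_{[ab]}`. -/
def alt {ι : Type*} (ψ : ι → ι → ℝ) (a b : ι) : ℝ := (ψ a b - ψ b a) / 2

/-- Antisymmetrization `ψ_{[abc]}`. -/
def alt₃ {ι : Type*} (ψ : ι → ι → ι → ℝ) (a b c : ι) : ℝ :=
  (ψ a b c + ψ b c a + ψ c a b - ψ b a c - ψ a c b - ψ c b a) / 6

namespace OrthogonalFoliation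

variable {m : ℕ} {M : Type*} [TopologicalSpace M]
  [ChartedSpace (EuclideanSpace ℝ (Fin (m + 1))) M] [IsManifold (𝓡 (m + 1)) ∞ M]
  {G : RiemannCartan m M}

/-- The frame-dependent tensor `U_{abc}`. -/
def Uterm (F : OrthogonalFoliation G) (a b c : Fin m) (x : M) : ℝ :=
  sym (fun b c ↦ G.S₃ (F.V a) (F.e b) (F.e c) x) b c
    + (alt (fun b a ↦ G.S₃ (F.V c) (F.e b) (F.e a) x) b a
      + 1 / 2 * G.S₃ (F.e a) (F.e b) (F.V c) x)
    + alt (fun a b ↦ G.S₃ (F.e a) (F.e c) (F.V b) x) a b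
    - sym (fun a c ↦ G.S₃ (F.V b) (F.e a) (F.e c) x) a c

end OrthogonalFoliation

end

open scoped Topology
open VectorField

noncomputable section

/-! Both identities are curvature identities written out in a frame adapted to the leaves. For the
first, metric compatibility turns `R` into derivatives of scalars plus products of first covariant
derivatives (`R_eq`). With `n` in two slots the scalars are `-K` and `-acc`, and the bracket `[e_a,
n]` is replaced by `∇_a n - ∇_n e_a - 2S(e_a, n)`. For the second, torsion spoils the pair symmetry
of the curvature. Its defect is an alternating sum of four cyclic sums (`R_pair_swap`), each of
which the first Bianchi identity expresses through derivatives of the torsion (`bianchi`). The sum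
whose free slot is `n` involves only `S_{ab0}`. As the leaves are integrable, `S_{ab0} = -K_{[ab]}`
(`tors_e_e_normal`), and this produces `D_{[a}K_{bc]}`. It remains to split vectors into tangential
and normal parts. Each contraction over a frame index uses `e_a ⊗ e^a = id - ε n ⊗ g(n, ·)`
(`sum_coframe_mul`), and the explicit `ε` terms of the claim are the normal corrections that
survive. -/

lemma mvfderiv_congr_of_eqOn {m : ℕ} {M : Type*} [TopologicalSpace M]
    [ChartedSpace (EuclideanSpace ℝ (Fin (m + 1))) M] {U : Set M} {x : M} {f f' : M → ℝ}
    (hU : IsOpen U) (hx : x ∈ U) (h : ∀ y ∈ U, f y = f' y) :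
    mvfderiv (𝓡 (m + 1)) f x = mvfderiv (𝓡 (m + 1)) f' x := by
  have : f =ᶠ[𝓝 x] f' := Filter.eventuallyEq_of_mem (hU.mem_nhds hx) h
  ext v
  simp only [mvfderiv, this.mfderiv_eq]
  rfl

lemma mvfderiv_half_add {m : ℕ} {M : Type*} [TopologicalSpace M]
    [ChartedSpace (EuclideanSpace ℝ (Fin (m + 1))) M] {x : M} {f f' : M → ℝ}
    (hf : MDifferentiableAt (𝓡 (m + 1)) 𝓘(ℝ, ℝ) f x)
    (hf' : MDifferentiableAt (𝓡 (m + 1)) 𝓘(ℝ, ℝ) f' x) (v : TangentSpace (𝓡 (m + 1)) x) :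
    mvfderiv (𝓡 (m + 1)) (fun y ↦ (f y + f' y) / 2) x v =
      (mvfderiv (𝓡 (m + 1)) f x v + mvfderiv (𝓡 (m + 1)) f' x v) / 2 := by
  have h : (fun y ↦ (f y + f' y) / 2) = (fun _ ↦ (2⁻¹ : ℝ)) * (f + f') :=
    funext fun y ↦ by simp only [Pi.mul_apply, Pi.add_apply]; ring
  rw [h, mvfderiv_mul mdifferentiableAt_const (hf.add hf'), mvfderiv_add hf hf',
    mvfderiv_const]
  simp only [smul_apply, add_apply, smul_eq_mul, smul_zero, zero_apply]
  ring

lemma mvfderiv_half_sub {m : ℕ} {M : Type*} [TopologicalSpace M]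
    [ChartedSpace (EuclideanSpace ℝ (Fin (m + 1))) M] {x : M} {f f' : M → ℝ}
    (hf : MDifferentiableAt (𝓡 (m + 1)) 𝓘(ℝ, ℝ) f x)
    (hf' : MDifferentiableAt (𝓡 (m + 1)) 𝓘(ℝ, ℝ) f' x) (v : TangentSpace (𝓡 (m + 1)) x) :
    mvfderiv (𝓡 (m + 1)) (fun y ↦ (f y - f' y) / 2) x v =
      (mvfderiv (𝓡 (m + 1)) f x v - mvfderiv (𝓡 (m + 1)) f' x v) / 2 := by
  have h : (fun y ↦ (f y - f' y) / 2) = (fun y ↦ (f y + (-f') y) / 2) :=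
    funext fun y ↦ by simp only [Pi.neg_apply]; ring
  rw [h, mvfderiv_half_add hf hf'.neg, mvfderiv_neg, neg_apply, sub_eq_add_neg]

/-! ### Smooth vector fields and the Lie bracket as a commutator. -/

section VectorFields

variable {m : ℕ} {M : Type*} [TopologicalSpace M]
  [ChartedSpace (EuclideanSpace ℝ (Fin (m + 1))) M] [IsManifold (𝓡 (m + 1)) ∞ M]
  {X Y Z W : ∀ x : M, TangentSpace (𝓡 (m + 1)) x} {U : Set M} {x : M}

namespace VectorFieldSmoothOn

lemma contMDiffAt (hX : VectorFieldSmoothOn X U) (hU : IsOpen U) (hx : x ∈ U) :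
    ContMDiffAt (𝓡 (m + 1)) ((𝓡 (m + 1)).prod 𝓘(ℝ, EuclideanSpace ℝ (Fin (m + 1)))) ∞
      (fun y ↦ TotalSpace.mk' (EuclideanSpace ℝ (Fin (m + 1))) y (X y)) x :=
  ContMDiffOn.contMDiffAt hX (hU.mem_nhds hx)

lemma diffAt (hX : VectorFieldSmoothOn X U) (hU : IsOpen U) (hx : x ∈ U) :
    VectorFieldDiffAt X x :=
  (hX.contMDiffAt hU hx).mdifferentiableAt (by simp)

lemma mono {U' : Set M} (hX : VectorFieldSmoothOn X U) (h : U' ⊆ U) :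
    VectorFieldSmoothOn X U' :=
  ContMDiffOn.mono hX h

lemma mlieBracket (hX : VectorFieldSmoothOn X U) (hY : VectorFieldSmoothOn Y U) (hU : IsOpen U) :
    VectorFieldSmoothOn (mlieBracket (𝓡 (m + 1)) X Y) U := fun _ hx ↦
  have : IsManifold (𝓡 (m + 1)) (minSmoothness ℝ 2) M :=
    IsManifold.of_le (n := ∞) (by simpa using ENat.LEInfty.out)
  -- Since `∞ + 1` is `∞`, the bracket costs no smoothness.
  have : IsManifold (𝓡 (m + 1)) (((⊤ : ℕ∞) : WithTop ℕ∞) + 1) M := ‹IsManifold (𝓡 (m + 1)) ∞ M›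
  (ContMDiffAt.mlieBracket_vectorField (n := ⊤) (m := ⊤) (hX.contMDiffAt hU hx)
    (hY.contMDiffAt hU hx) (by simp)).contMDiffWithinAt

lemma sub (hX : VectorFieldSmoothOn X U) (hY : VectorFieldSmoothOn Y U) :
    VectorFieldSmoothOn (fun y ↦ X y - Y y) U :=
  ContMDiffOn.sub_section hX hY

lemma add (hX : VectorFieldSmoothOn X U) (hY : VectorFieldSmoothOn Y U) :
    VectorFieldSmoothOn (fun y ↦ X y + Y y) U :=
  ContMDiffOn.add_section hX hY

lemma smul {f : M → ℝ} (hf : ContMDiffOn (𝓡 (m + 1)) 𝓘(ℝ, ℝ) ∞ f U)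
    (hX : VectorFieldSmoothOn X U) :
    VectorFieldSmoothOn (fun y ↦ f y • X y) U :=
  ContMDiffOn.smul_section hf hX

lemma const_smul (c : ℝ) (hX : VectorFieldSmoothOn X U) :
    VectorFieldSmoothOn (fun y ↦ c • X y) U :=
  ContMDiffOn.const_smul_section hX

lemma congr (hX : VectorFieldSmoothOn X U) (h : ∀ y ∈ U, Y y = X y) :
    VectorFieldSmoothOn Y U :=
  ContMDiffOn.congr hX fun y hy ↦ by simp only [h y hy]

end VectorFieldSmoothOn

/-- `[X, Y] f = X (Y f) - Y (X f)`. -/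
lemma mvfderiv_mlieBracket (hU : IsOpen U) (hx : x ∈ U) {f : M → ℝ}
    (hf : ContMDiffOn (𝓡 (m + 1)) 𝓘(ℝ, ℝ) ∞ f U) (hX : VectorFieldSmoothOn X U)
    (hY : VectorFieldSmoothOn Y U) (hZ : VectorFieldSmoothOn Z U) (hZx : Z x ≠ 0)
    (hXf : MDifferentiableAt (𝓡 (m + 1)) 𝓘(ℝ, ℝ)
      (fun y ↦ mvfderiv (𝓡 (m + 1)) f y (X y)) x)
    (hYf : MDifferentiableAt (𝓡 (m + 1)) 𝓘(ℝ, ℝ)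
      (fun y ↦ mvfderiv (𝓡 (m + 1)) f y (Y y)) x) :
    mvfderiv (𝓡 (m + 1)) f x (VectorField.mlieBracket (𝓡 (m + 1)) X Y x) =
      mvfderiv (𝓡 (m + 1)) (fun y ↦ mvfderiv (𝓡 (m + 1)) f y (Y y)) x (X x)
      - mvfderiv (𝓡 (m + 1)) (fun y ↦ mvfderiv (𝓡 (m + 1)) f y (X y)) x (Y x) := by
  have hfd : ∀ y ∈ U, MDifferentiableAt (𝓡 (m + 1)) 𝓘(ℝ, ℝ) f y := fun y hy ↦
    (hf.contMDiffAt (hU.mem_nhds hy)).mdifferentiableAt (by simp)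
  -- The formula is extracted from the Jacobi identity for `X`, `Y`, `f • Z`: two applications of
  -- the Leibniz rule make second derivatives of `f` appear as coefficients of `Z`.
  have hfZ : VectorFieldSmoothOn (f • Z) U := hZ.smul hf
  have key : ∀ {A B : ∀ x : M, TangentSpace (𝓡 (m + 1)) x}, VectorFieldSmoothOn A U →
      VectorFieldSmoothOn B U →
      MDifferentiableAt (𝓡 (m + 1)) 𝓘(ℝ, ℝ) (fun y ↦ mvfderiv (𝓡 (m + 1)) f y (B y)) x →
      VectorField.mlieBracket (𝓡 (m + 1)) A (VectorField.mlieBracket (𝓡 (m + 1)) B (f • Z)) x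
      = mvfderiv (𝓡 (m + 1)) (fun y ↦ mvfderiv (𝓡 (m + 1)) f y (B y)) x (A x) • Z x
        + mvfderiv (𝓡 (m + 1)) f x (B x) • VectorField.mlieBracket (𝓡 (m + 1)) A Z x
        + mvfderiv (𝓡 (m + 1)) f x (A x) • VectorField.mlieBracket (𝓡 (m + 1)) B Z x
        + f x • VectorField.mlieBracket (𝓡 (m + 1)) A
            (VectorField.mlieBracket (𝓡 (m + 1)) B Z) x := by
    intro A B hA hB hBf
    have h1 : VectorField.mlieBracket (𝓡 (m + 1)) B (f • Z) =ᶠ[𝓝 x]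
        (fun y ↦ mvfderiv (𝓡 (m + 1)) f y (B y)) • Z
          + f • VectorField.mlieBracket (𝓡 (m + 1)) B Z :=
      Filter.eventuallyEq_of_mem (hU.mem_nhds hx) fun y hy ↦
        mlieBracket_smul_right (hfd y hy) (hZ.diffAt hU hy)
    refine (Filter.EventuallyEq.mlieBracket_vectorField_eq Filter.EventuallyEq.rfl h1).trans ?_
    rw [mlieBracket_add_right, mlieBracket_smul_right hBf (hZ.diffAt hU hx),
      mlieBracket_smul_right (hfd x hx) ((hB.mlieBracket hZ hU).diffAt hU hx)]
    · simp only [add_assoc]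
    · exact MDifferentiableAt.smul_section hBf (hZ.diffAt hU hx)
    · exact MDifferentiableAt.smul_section (hfd x hx) ((hB.mlieBracket hZ hU).diffAt hU hx)
  have two : ∀ {A : ∀ x : M, TangentSpace (𝓡 (m + 1)) x}, VectorFieldSmoothOn A U →
      ContMDiffAt (𝓡 (m + 1)) ((𝓡 (m + 1)).prod 𝓘(ℝ, EuclideanSpace ℝ (Fin (m + 1))))
        (minSmoothness ℝ 2)
        (fun y ↦ TotalSpace.mk' (EuclideanSpace ℝ (Fin (m + 1))) y (A y)) x := fun hA ↦
    (hA.contMDiffAt hU hx).of_le (by simpa using ENat.LEInfty.out)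
  have : IsManifold (𝓡 (m + 1)) (minSmoothness ℝ 3) M :=
    IsManifold.of_le (n := ∞) (by simpa using ENat.LEInfty.out)
  have jf := leibniz_identity_mlieBracket_apply (two hX) (two hY) (two hfZ)
  have j := leibniz_identity_mlieBracket_apply (two hX) (two hY) (two hZ)
  rw [key hX hY hYf, key hY hX hXf,
    mlieBracket_smul_right (hfd x hx) (hZ.diffAt hU hx), j] at jf
  -- The mixed first-order terms are symmetric in `X`, `Y` or match those of `[[X, Y], f • Z]`, and
  -- the terms with factor `f` cancel by Jacobi for `Z`. What is left is a scalar multiple of `Z x`,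
  -- so the scalar vanishes.
  refine sub_eq_zero.1 ((smul_eq_zero.1 (?_ : _ • Z x = 0)).resolve_right hZx)
  refine Eq.trans ?_ (neg_eq_zero.2 (sub_eq_zero.2 jf))
  module

end VectorFields

/-! ### Curvature symmetries and the Bianchi identity in the presence of torsion. -/

namespace RiemannCartan

variable {m : ℕ} {M : Type*} [TopologicalSpace M]
  [ChartedSpace (EuclideanSpace ℝ (Fin (m + 1))) M] [IsManifold (𝓡 (m + 1)) ∞ M]
  (G : RiemannCartan m M)
  {X Y Z W : ∀ x : M, TangentSpace (𝓡 (m + 1)) x} {U : Set M} {x : M}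

lemma g_smoothOn (hX : VectorFieldSmoothOn X U) (hY : VectorFieldSmoothOn Y U) :
    ContMDiffOn (𝓡 (m + 1)) 𝓘(ℝ, ℝ) ∞ (fun y ↦ G.g y (X y) (Y y)) U := by
  intro y hy
  have := ContMDiffWithinAt.clm_bundle_apply₂ (F₁ := EuclideanSpace ℝ (Fin (m + 1)))
    (F₂ := EuclideanSpace ℝ (Fin (m + 1))) (F₃ := ℝ) (E₃ := Bundle.Trivial M ℝ)
    (G.g_smooth.contMDiffOn y hy) (hX y hy) (hY y hy)
  simp only [contMDiffWithinAt_totalSpace] at this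
  exact this.2

lemma diffAt_g (hU : IsOpen U) (hx : x ∈ U) (hX : VectorFieldSmoothOn X U)
    (hY : VectorFieldSmoothOn Y U) :
    MDifferentiableAt (𝓡 (m + 1)) 𝓘(ℝ, ℝ) (fun y ↦ G.g y (X y) (Y y)) x :=
  ((G.g_smoothOn hX hY).contMDiffAt (hU.mem_nhds hx)).mdifferentiableAt (by simp)

lemma nabla_smoothOn (hU : IsOpen U) (hX : VectorFieldSmoothOn X U)
    (hY : VectorFieldSmoothOn Y U) : VectorFieldSmoothOn (G.nabla X Y) U :=
  ContMDiffOn.clm_bundle_apply ((G.conn_smooth U hU).contMDiff hY) hX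

lemma two_smul_S (hX : VectorFieldDiffAt X x) (hY : VectorFieldDiffAt Y x) :
    (2 : ℝ) • G.S X Y x = G.nabla X Y x - G.nabla Y X x - mlieBracket (𝓡 (m + 1)) X Y x := by
  rw [S, smul_smul, G.conn.torsion_apply hX hY]
  norm_num [nabla]

lemma S_smoothOn (hU : IsOpen U) (hX : VectorFieldSmoothOn X U) (hY : VectorFieldSmoothOn Y U) :
    VectorFieldSmoothOn (G.S X Y) U := by
  refine ((((G.nabla_smoothOn hU hX hY).sub (G.nabla_smoothOn hU hY hX)).sub
    (hX.mlieBracket hY hU)).const_smul (1 / 2)).congr fun y hy ↦ ?_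
  rw [← G.two_smul_S (hX.diffAt hU hy) (hY.diffAt hU hy), smul_smul]
  norm_num

/-- The torsion tensor `S_{αβγ}` at a point. -/
def tors (x : M) (u v w : TangentSpace (𝓡 (m + 1)) x) : ℝ :=
  G.g x ((1 / 2 : ℝ) • G.conn.torsion x u v) w

lemma diffAt_S₃ (hU : IsOpen U) (hx : x ∈ U) (hX : VectorFieldSmoothOn X U)
    (hY : VectorFieldSmoothOn Y U) (hZ : VectorFieldSmoothOn Z U) :
    MDifferentiableAt (𝓡 (m + 1)) 𝓘(ℝ, ℝ) (G.S₃ X Y Z) x :=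
  G.diffAt_g hU hx (G.S_smoothOn hU hX hY) hZ

section tors

variable (u u' v v' w w' : TangentSpace (𝓡 (m + 1)) x) (c : ℝ)

lemma tors_swap : G.tors x u v w = -G.tors x v u w := by
  rw [tors, G.conn.torsion_antisymm]; simp [tors]

lemma tors_self : G.tors x u u w = 0 := by
  simp [tors]

lemma tors_add_left : G.tors x (u + u') v w = G.tors x u v w + G.tors x u' v w := by
  simp [tors]

lemma tors_smul_left : G.tors x (c • u) v w = c * G.tors x u v w := by
  simp [tors, mul_left_comm]

lemma tors_add_middle : G.tors x u (v + v') w = G.tors x u v w + G.tors x u v' w := by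
  simp [tors]

lemma tors_sub_middle : G.tors x u (v - v') w = G.tors x u v w - G.tors x u v' w := by
  simp [tors, mul_sub]

lemma tors_smul_middle : G.tors x u (c • v) w = c * G.tors x u v w := by
  simp [tors, mul_left_comm]

lemma tors_add_right : G.tors x u v (w + w') = G.tors x u v w + G.tors x u v w' := by
  simp [tors, mul_add]

lemma tors_smul_right : G.tors x u v (c • w) = c * G.tors x u v w := by
  simp [tors]

end tors

lemma exists_g_ne_zero {v : TangentSpace (𝓡 (m + 1)) x} (hv : v ≠ 0) :
    ∃ w, G.g x v w ≠ 0 := by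
  obtain ⟨t, -, ht⟩ := G.g_lorentzian x
  by_contra! h
  exact (ht v (by rw [G.g_symm, h]) hv).ne' (h v)

/-- The metric form of the second covariant derivative. -/
lemma g_nabla_nabla (hU : IsOpen U) (hx : x ∈ U) (hY : VectorFieldSmoothOn Y U)
    (hZ : VectorFieldSmoothOn Z U) (v : TangentSpace (𝓡 (m + 1)) x) :
    G.g x (G.conn Y x v) (Z x) = mvfderiv (𝓡 (m + 1)) (fun y ↦ G.g y (Y y) (Z y)) x v
      - G.g x (Y x) (G.conn Z x v) := by
  rw [G.conn_metric x Y Z v (hY.diffAt hU hx) (hZ.diffAt hU hx)]; ring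

/-- Metric compatibility moves the outer derivative off the vector field, so that only derivatives
of scalars and first covariant derivatives remain. -/
lemma R_eq (hU : IsOpen U) (hx : x ∈ U) (hX : VectorFieldSmoothOn X U)
    (hY : VectorFieldSmoothOn Y U) (hZ : VectorFieldSmoothOn Z U) (hW : VectorFieldSmoothOn W U) :
    G.R X Y Z W x =
      mvfderiv (𝓡 (m + 1)) (fun y ↦ G.g y (G.nabla X Z y) (W y)) x (Y x)
      - G.g x (G.nabla X Z x) (G.nabla Y W x)
      - mvfderiv (𝓡 (m + 1)) (fun y ↦ G.g y (G.nabla Y Z y) (W y)) x (X x)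
      + G.g x (G.nabla Y Z x) (G.nabla X W x)
      + G.g x (G.conn Z x (mlieBracket (𝓡 (m + 1)) X Y x)) (W x) := by
  simp only [R, riem, map_add, map_sub, add_apply,
    sub_apply]
  have h1 := G.g_nabla_nabla hU hx (G.nabla_smoothOn hU hX hZ) hW (Y x)
  have h2 := G.g_nabla_nabla hU hx (G.nabla_smoothOn hU hY hZ) hW (X x)
  simp only [nabla] at h1 h2 ⊢
  rw [h1, h2]
  ring

lemma R_swap_left : G.R X Y Z W x = -G.R Y X Z W x := by
  simp only [R, riem, map_add, map_sub, add_apply,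
    sub_apply, nabla]
  rw [mlieBracket_swap_apply]
  simp only [map_neg, neg_apply]
  ring

/-- The symmetric part in `Z`, `W` is the operator `YX - XY + [X, Y]` applied to the function `g(Z,
W)`, hence zero. The field `X` also serves as the nonvanishing auxiliary field in
`mvfderiv_mlieBracket`. -/
lemma R_swap_right (hU : IsOpen U) (hx : x ∈ U) (hX : VectorFieldSmoothOn X U)
    (hY : VectorFieldSmoothOn Y U) (hZ : VectorFieldSmoothOn Z U) (hW : VectorFieldSmoothOn W U)
    (hXx : X x ≠ 0) :
    G.R X Y Z W x = -G.R X Y W Z x := by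
  have hd : ∀ {V : ∀ x : M, TangentSpace (𝓡 (m + 1)) x}, ∀ y ∈ U,
      mvfderiv (𝓡 (m + 1)) (fun y ↦ G.g y (Z y) (W y)) y (V y)
      = G.g y (G.nabla V Z y) (W y) + G.g y (G.nabla V W y) (Z y) := fun y hy ↦ by
    rw [G.conn_metric y Z W _ (hZ.diffAt hU hy) (hW.diffAt hU hy), G.g_symm y (Z y)]; rfl
  -- Metric compatibility writes the derivative of `g(Z, W)` as a sum of smooth inner products,
  -- which gives the differentiability needed for the second derivatives.
  have hdd : ∀ {V : ∀ x : M, TangentSpace (𝓡 (m + 1)) x}, VectorFieldSmoothOn V U →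
      ContMDiffOn (𝓡 (m + 1)) 𝓘(ℝ, ℝ) ∞
        (fun y ↦ mvfderiv (𝓡 (m + 1)) (fun y ↦ G.g y (Z y) (W y)) y (V y)) U := fun hV ↦
    ((G.g_smoothOn (G.nabla_smoothOn hU hV hZ) hW).add
      (G.g_smoothOn (G.nabla_smoothOn hU hV hW) hZ)).congr hd
  have hs : ∀ {V V' : ∀ x : M, TangentSpace (𝓡 (m + 1)) x}, VectorFieldSmoothOn V U →
      mvfderiv (𝓡 (m + 1)) (fun y ↦ mvfderiv (𝓡 (m + 1)) (fun y ↦ G.g y (Z y) (W y)) y (V y)) x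
        (V' x) = mvfderiv (𝓡 (m + 1)) (fun y ↦ G.g y (G.nabla V Z y) (W y)) x (V' x)
        + mvfderiv (𝓡 (m + 1)) (fun y ↦ G.g y (G.nabla V W y) (Z y)) x (V' x) := fun hV ↦ by
    rw [mvfderiv_congr_of_eqOn hU hx hd,
      mvfderiv_fun_add (G.diffAt_g hU hx (G.nabla_smoothOn hU hV hZ) hW)
      (G.diffAt_g hU hx (G.nabla_smoothOn hU hV hW) hZ)]
    rfl
  have hc := mvfderiv_mlieBracket hU hx (G.g_smoothOn hZ hW) hX hY hX hXx
    (((hdd hX).contMDiffAt (hU.mem_nhds hx)).mdifferentiableAt (by simp))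
    (((hdd hY).contMDiffAt (hU.mem_nhds hx)).mdifferentiableAt (by simp))
  rw [hs hX, hs hY, hd (V := mlieBracket (𝓡 (m + 1)) X Y) x hx] at hc
  rw [G.R_eq hU hx hX hY hZ hW, G.R_eq hU hx hX hY hW hZ,
    G.g_symm x (G.nabla Y W x), G.g_symm x (G.nabla X W x)]
  simp only [nabla] at hc ⊢
  linear_combination hc

/-- The first Bianchi identity for a connection with torsion. -/
lemma bianchi (hU : IsOpen U) (hx : x ∈ U) (hX : VectorFieldSmoothOn X U)
    (hY : VectorFieldSmoothOn Y U) (hZ : VectorFieldSmoothOn Z U) (hW : VectorFieldSmoothOn W U) :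
    G.R X Y Z W x + G.R Y Z X W x + G.R Z X Y W x =
      -2 * ((mvfderiv (𝓡 (m + 1)) (G.S₃ Y Z W) x (X x)
          - G.tors x (Y x) (Z x) (G.nabla X W x)
          + G.tors x (X x) (mlieBracket (𝓡 (m + 1)) Y Z x) (W x))
        + (mvfderiv (𝓡 (m + 1)) (G.S₃ Z X W) x (Y x)
          - G.tors x (Z x) (X x) (G.nabla Y W x)
          + G.tors x (Y x) (mlieBracket (𝓡 (m + 1)) Z X x) (W x))
        + (mvfderiv (𝓡 (m + 1)) (G.S₃ X Y W) x (Z x)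
          - G.tors x (X x) (Y x) (G.nabla Z W x)
          + G.tors x (Z x) (mlieBracket (𝓡 (m + 1)) X Y x) (W x))) := by
  -- One summand of the cyclic sum: differentiate the torsion equation for `Y`, `Z` along `X`, then
  -- use the torsion equation for `X`, `[Y, Z]` to eliminate `∇_X [Y, Z]`.
  have key : ∀ {X Y Z : ∀ x : M, TangentSpace (𝓡 (m + 1)) x}, VectorFieldSmoothOn X U →
      VectorFieldSmoothOn Y U → VectorFieldSmoothOn Z U →
      2 * (mvfderiv (𝓡 (m + 1)) (G.S₃ Y Z W) x (X x) - G.tors x (Y x) (Z x) (G.nabla X W x)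
        + G.tors x (X x) (mlieBracket (𝓡 (m + 1)) Y Z x) (W x))
      = G.g x (G.nabla X (G.nabla Y Z) x) (W x) - G.g x (G.nabla X (G.nabla Z Y) x) (W x)
        - G.g x (G.nabla (mlieBracket (𝓡 (m + 1)) Y Z) X x) (W x)
        - G.g x (mlieBracket (𝓡 (m + 1)) X (mlieBracket (𝓡 (m + 1)) Y Z) x) (W x) := by
    intro X Y Z hX hY hZ
    have hb := hY.mlieBracket hZ hU
    have hS := G.S_smoothOn hU hY hZ
    have h1 : G.conn (G.nabla Y Z) x = G.conn (G.nabla Z Y) x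
        + G.conn (mlieBracket (𝓡 (m + 1)) Y Z) x + (2 : ℝ) • G.conn (G.S Y Z) x := by
      have h2 : VectorFieldDiffAt ((2 : ℝ) • G.S Y Z) x := (hS.const_smul 2).diffAt hU hx
      have h3 : VectorFieldSmoothOn (G.nabla Z Y + mlieBracket (𝓡 (m + 1)) Y Z) U :=
        (G.nabla_smoothOn hU hZ hY).add hb
      rw [← G.conn.isCovariantDerivativeOn.smul_const (2 : ℝ) (hS.diffAt hU hx),
        ← G.conn.isCovariantDerivativeOn.add ((G.nabla_smoothOn hU hZ hY).diffAt hU hx)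
          (hb.diffAt hU hx), ← G.conn.isCovariantDerivativeOn.add (h3.diffAt hU hx) h2]
      refine G.conn.isCovariantDerivativeOn.congr_of_eqOn
        ((G.nabla_smoothOn hU hY hZ).diffAt hU hx)
        ((h3.add (hS.const_smul 2)).diffAt hU hx) (hU.mem_nhds hx) fun y hy ↦ ?_
      simp only [Pi.add_apply, Pi.smul_apply]
      rw [G.two_smul_S (hY.diffAt hU hy) (hZ.diffAt hU hy)]
      abel
    have h4 := G.two_smul_S (hX.diffAt hU hx) (hb.diffAt hU hx)
    have h5 := G.g_nabla_nabla hU hx hS hW (X x)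
    have h6 : G.tors x (X x) (mlieBracket (𝓡 (m + 1)) Y Z x) (W x)
      = G.g x (G.S X (mlieBracket (𝓡 (m + 1)) Y Z) x) (W x) := rfl
    have h7 := congrArg (fun v ↦ G.g x v (W x)) h4
    have h8 := congrArg (fun v ↦ G.g x (v (X x)) (W x)) h1
    simp only [map_sub, map_add, map_smul, add_apply, smul_eq_mul,
      sub_apply, smul_apply, nabla] at h7 h8
    have h9 : mvfderiv (𝓡 (m + 1)) (G.S₃ Y Z W) x (X x) - G.tors x (Y x) (Z x) (G.nabla X W x)
      = G.g x (G.conn (G.S Y Z) x (X x)) (W x) := h5.symm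
    rw [h9, h6]
    simp only [nabla] at h7 h8 ⊢
    linear_combination h7 - h8
  have two : ∀ {A : ∀ x : M, TangentSpace (𝓡 (m + 1)) x}, VectorFieldSmoothOn A U →
      ContMDiffAt (𝓡 (m + 1)) ((𝓡 (m + 1)).prod 𝓘(ℝ, EuclideanSpace ℝ (Fin (m + 1))))
        (minSmoothness ℝ 2)
        (fun y ↦ TotalSpace.mk' (EuclideanSpace ℝ (Fin (m + 1))) y (A y)) x := fun hA ↦
    (hA.contMDiffAt hU hx).of_le (by simpa using ENat.LEInfty.out)
  have : IsManifold (𝓡 (m + 1)) (minSmoothness ℝ 3) M :=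
    IsManifold.of_le (n := ∞) (by simpa using ENat.LEInfty.out)
  -- In the cyclic sum of `key` the double brackets cancel by Jacobi and the rest assembles into
  -- three curvatures.
  have j := congrArg (fun v ↦ G.g x v (W x))
    (leibniz_identity_mlieBracket_apply (two hX) (two hY) (two hZ))
  rw [mlieBracket_swap_apply (V := mlieBracket (𝓡 (m + 1)) X Y),
    mlieBracket_swap (V := X) (W := Z)] at j
  have k1 := key hX hY hZ
  have k2 := key hY hZ hX
  have k3 := key hZ hX hY
  have j' : mlieBracket (𝓡 (m + 1)) Y (-mlieBracket (𝓡 (m + 1)) Z X) x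
      = -mlieBracket (𝓡 (m + 1)) Y (mlieBracket (𝓡 (m + 1)) Z X) x := by
    rw [← neg_one_smul ℝ (mlieBracket (𝓡 (m + 1)) Z X),
      mlieBracket_const_smul_right ((hZ.mlieBracket hX hU).diffAt hU hx), neg_one_smul]
  simp only [j', map_add, map_neg, add_apply,
    neg_apply] at j
  simp only [R, riem, map_add, map_sub, add_apply,
    sub_apply]
  linear_combination k1 + k2 + k3 - j

/-- Pair symmetry of the Riemann tensor, up to Bianchi sums. -/
lemma R_pair_swap (hU : IsOpen U) (hx : x ∈ U) (hX : VectorFieldSmoothOn X U)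
    (hY : VectorFieldSmoothOn Y U) (hZ : VectorFieldSmoothOn Z U) (hW : VectorFieldSmoothOn W U)
    (hXx : X x ≠ 0) (hYx : Y x ≠ 0) (hZx : Z x ≠ 0) (hWx : W x ≠ 0) :
    2 * (G.R X Y Z W x - G.R Z W X Y x) =
      (G.R X Y Z W x + G.R Y Z X W x + G.R Z X Y W x)
      - (G.R W X Y Z x + G.R X Y W Z x + G.R Y W X Z x)
      + (G.R Y Z W X x + G.R Z W Y X x + G.R W Y Z X x)
      - (G.R Z W X Y x + G.R W X Z Y x + G.R X Z W Y x) := by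
  -- Of the twelve terms on the right, eight cancel in pairs by skew symmetry in the first or last
  -- two slots; the other four double up to the left side.
  rw [G.R_swap_right hU hx hX hY hW hZ hXx, G.R_swap_right hU hx hY hZ hW hX hYx,
    G.R_swap_right hU hx hZ hW hY hX hZx, G.R_swap_left (X := W) (Y := Y),
    G.R_swap_right hU hx hY hW hZ hX hYx, G.R_swap_right hU hx hW hX hZ hY hWx,
    G.R_swap_left (X := X) (Y := Z), G.R_swap_right hU hx hZ hX hW hY hZx]
  ring

end RiemannCartan

/-! ### Normal and tangential parts, second fundamental form, integrability. -/

namespace OrthogonalFoliation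

variable {m : ℕ} {M : Type*} [TopologicalSpace M]
  [ChartedSpace (EuclideanSpace ℝ (Fin (m + 1))) M] [IsManifold (𝓡 (m + 1)) ∞ M]
  {G : RiemannCartan m M} (F : OrthogonalFoliation G)
  (X : ∀ x : M, TangentSpace (𝓡 (m + 1)) x) {x : M}

lemma ε_mul_ε : F.ε * F.ε = 1 := by
  rcases F.ε_eq with h | h <;> rw [h] <;> norm_num

lemma ε_ne_zero : F.ε ≠ 0 := fun h ↦ by
  simpa [h] using F.ε_mul_ε

lemma n_ne_zero (hx : x ∈ F.U) : F.n x ≠ 0 := fun h ↦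
  F.ε_ne_zero (by rw [← F.n_unit x hx, h]; simp)

lemma e_ne_zero (hx : x ∈ F.U) (a : Fin m) : F.e a x ≠ 0 :=
  (F.e_linearIndependent x hx).ne_zero a

/-- The `e_a` lie in the orthogonal complement of `n`, which does not contain `n` because `ε ≠ 0`;
the dimension count does the rest. -/
lemma span_frame (hx : x ∈ F.U) :
    Submodule.span ℝ (Set.range (Fin.cons (F.n x) (fun a ↦ F.e a x) :
      Fin (m + 1) → TangentSpace (𝓡 (m + 1)) x)) = ⊤ := by
  have hli : LinearIndependent ℝ (Fin.cons (F.n x) (fun a ↦ F.e a x) :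
      Fin (m + 1) → TangentSpace (𝓡 (m + 1)) x) := by
    refine linearIndependent_finCons.2 ⟨F.e_linearIndependent x hx, fun h ↦ F.ε_ne_zero ?_⟩
    have hle : Submodule.span ℝ (Set.range fun a ↦ F.e a x) ≤
        LinearMap.ker (G.g x (F.n x)).toLinearMap :=
      Submodule.span_le.2 (by rintro _ ⟨a, rfl⟩; exact F.e_tangent x hx a)
    rw [← F.n_unit x hx]
    exact hle h
  have hfr : Module.finrank ℝ (TangentSpace (𝓡 (m + 1)) x) = m + 1 :=
    finrank_euclideanSpace_fin (𝕜 := ℝ) (n := m + 1)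
  have : FiniteDimensional ℝ (TangentSpace (𝓡 (m + 1)) x) :=
    Module.finite_of_finrank_pos (by rw [hfr]; omega)
  exact hli.span_eq_top_of_card_eq_finrank' (by rw [hfr, Fintype.card_fin])

lemma eq_zero_of_orthogonal (hx : x ∈ F.U) {w : TangentSpace (𝓡 (m + 1)) x}
    (hn : G.g x (F.n x) w = 0) (he : ∀ a, G.g x (F.e a x) w = 0) : w = 0 := by
  by_contra hw
  obtain ⟨v, hv⟩ := G.exists_g_ne_zero hw
  have hle : (⊤ : Submodule ℝ (TangentSpace (𝓡 (m + 1)) x)) ≤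
      LinearMap.ker (G.g x w).toLinearMap := by
    rw [← F.span_frame hx, Submodule.span_le]
    rintro _ ⟨i, rfl⟩
    refine Fin.cases ?_ (fun a ↦ ?_) i
    · exact (G.g_symm x _ _).trans hn
    · exact (G.g_symm x _ _).trans (he a)
  exact hv (hle Submodule.mem_top)

/-- A null vector of `h` would be a combination of the `e_a` orthogonal to the whole frame, hence
zero by nondegeneracy of `g`. -/
lemma det_h_ne_zero (hx : x ∈ F.U) : (F.h x).det ≠ 0 := by
  intro h0
  obtain ⟨v, hv, hv0⟩ := Matrix.exists_mulVec_eq_zero_iff.2 h0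
  have hw : ∑ b, v b • F.e b x = 0 := by
    refine F.eq_zero_of_orthogonal hx ?_ fun a ↦ ?_
    · simp [F.e_tangent x hx]
    · have := congrFun hv0 a
      simpa [Matrix.mulVec, dotProduct, h, mul_comm] using this
  exact hv (funext (Fintype.linearIndependent_iff.1 (F.e_linearIndependent x hx) v hw))

lemma sum_h_mul_coframe (hx : x ∈ F.U) (b : Fin m) :
    ∑ c, F.h x b c * F.coframe c X x = G.g x (F.e b x) (X x) := by
  have hd : IsUnit (F.h x).det := (F.det_h_ne_zero hx).isUnit
  have : (F.h x).mulVec ((F.h x)⁻¹.mulVec fun b ↦ G.g x (F.e b x) (X x)) b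
      = G.g x (F.e b x) (X x) := by
    rw [Matrix.mulVec_mulVec, Matrix.mul_nonsing_inv _ hd, Matrix.one_mulVec]
  exact this

lemma hInv_symm (a b : Fin m) : F.hInv a b x = F.hInv b a x := by
  have : (F.h x).transpose = F.h x := by
    ext i j; exact G.g_symm x _ _
  rw [hInv, hInv, ← Matrix.transpose_apply (F.h x)⁻¹, Matrix.transpose_nonsing_inv, this]

/-- Decomposition of a vector into its normal and tangential parts. -/
lemma sum_coframe_smul (hx : x ∈ F.U) :
    ∑ a, F.coframe a X x • F.e a x = X x - (F.ε * G.g x (F.n x) (X x)) • F.n x := by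
  refine sub_eq_zero.1 (F.eq_zero_of_orthogonal hx ?_ fun b ↦ ?_)
  · simp only [map_sub, map_sum, map_smul, F.e_tangent x hx, F.n_unit x hx, smul_eq_mul, mul_zero,
      Finset.sum_const_zero]
    linear_combination G.g x (F.n x) (X x) * F.ε_mul_ε
  · have := F.sum_h_mul_coframe X hx b
    simp only [h, Matrix.of_apply] at this
    simp only [map_sub, map_sum, map_smul, smul_eq_mul, G.g_symm x (F.e b x) (F.n x),
      F.e_tangent x hx, ← this, zero_mul, sub_zero, mul_comm, sub_self]

/-- The contraction rule used for every repeated Latin index: the coframe forgets the normal part of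
`X`, and the last term records what was lost. -/
lemma sum_coframe_mul (hx : x ∈ F.U) (L : TangentSpace (𝓡 (m + 1)) x →ₗ[ℝ] ℝ) :
    ∑ a, F.coframe a X x * L (F.e a x) =
      L (X x) - F.ε * G.g x (F.n x) (X x) * L (F.n x) := by
  simpa only [map_sum, map_sub, map_smul, smul_eq_mul] using congrArg L (F.sum_coframe_smul X hx)

lemma sum_coframe_mul_tors_left (hx : x ∈ F.U) (v w : TangentSpace (𝓡 (m + 1)) x) :
    ∑ a, F.coframe a X x * G.tors x (F.e a x) v w =
      G.tors x (X x) v w - F.ε * G.g x (F.n x) (X x) * G.tors x (F.n x) v w :=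
  F.sum_coframe_mul X hx
    { toFun := fun u ↦ G.tors x u v w
      map_add' := fun _ _ ↦ G.tors_add_left ..
      map_smul' := fun _ _ ↦ G.tors_smul_left .. }

lemma sum_coframe_mul_tors_middle (hx : x ∈ F.U) (u w : TangentSpace (𝓡 (m + 1)) x) :
    ∑ a, F.coframe a X x * G.tors x u (F.e a x) w =
      G.tors x u (X x) w - F.ε * G.g x (F.n x) (X x) * G.tors x u (F.n x) w :=
  F.sum_coframe_mul X hx
    { toFun := fun v ↦ G.tors x u v w
      map_add' := fun _ _ ↦ G.tors_add_middle ..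
      map_smul' := fun _ _ ↦ G.tors_smul_middle .. }

lemma sum_coframe_mul_tors_right (hx : x ∈ F.U) (u v : TangentSpace (𝓡 (m + 1)) x) :
    ∑ a, F.coframe a X x * G.tors x u v (F.e a x) =
      G.tors x u v (X x) - F.ε * G.g x (F.n x) (X x) * G.tors x u v (F.n x) :=
  F.sum_coframe_mul X hx
    { toFun := fun w ↦ G.tors x u v w
      map_add' := fun _ _ ↦ G.tors_add_right ..
      map_smul' := fun _ _ ↦ G.tors_smul_right .. }

/-- The bilinear form `g(∇_u n, w)`, which extends the second fundamental form. -/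
def weingarten (x : M) (u w : TangentSpace (𝓡 (m + 1)) x) : ℝ :=
  G.g x (G.conn F.n x u) w

lemma weingarten_sub_left (u u' w : TangentSpace (𝓡 (m + 1)) x) :
    F.weingarten x (u - u') w = F.weingarten x u w - F.weingarten x u' w := by
  simp [weingarten]

lemma weingarten_smul_left (c : ℝ) (u w : TangentSpace (𝓡 (m + 1)) x) :
    F.weingarten x (c • u) w = c * F.weingarten x u w := by
  simp [weingarten]

lemma weingarten_sub_right (u w w' : TangentSpace (𝓡 (m + 1)) x) :
    F.weingarten x u (w - w') = F.weingarten x u w - F.weingarten x u w' := by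
  simp [weingarten]

lemma weingarten_smul_right (c : ℝ) (u w : TangentSpace (𝓡 (m + 1)) x) :
    F.weingarten x u (c • w) = c * F.weingarten x u w := by
  simp [weingarten]

lemma sum_coframe_mul_weingarten_left (hx : x ∈ F.U) (w : TangentSpace (𝓡 (m + 1)) x) :
    ∑ a, F.coframe a X x * F.weingarten x (F.e a x) w =
      F.weingarten x (X x) w
        - F.ε * G.g x (F.n x) (X x) * F.weingarten x (F.n x) w :=
  F.sum_coframe_mul X hx
    { toFun := fun u ↦ F.weingarten x u w
      map_add' := fun _ _ ↦ by simp [weingarten]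
      map_smul' := fun _ _ ↦ F.weingarten_smul_left .. }

lemma weingarten_normal (hx : x ∈ F.U) (u : TangentSpace (𝓡 (m + 1)) x) :
    F.weingarten x u (F.n x) = 0 := by
  have hn := F.n_smooth.diffAt F.isOpen_U hx
  have h := G.conn_metric x F.n F.n u hn hn
  rw [mvfderiv_congr_of_eqOn F.isOpen_U hx F.n_unit, mvfderiv_const,
    G.g_symm x (F.n x)] at h
  simp only [zero_apply] at h
  rw [weingarten]
  linarith

lemma sum_coframe_mul_weingarten_right (hx : x ∈ F.U) (u : TangentSpace (𝓡 (m + 1)) x) :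
    ∑ a, F.coframe a X x * F.weingarten x u (F.e a x) = F.weingarten x u (X x) := by
  have := F.sum_coframe_mul X hx (G.g x (G.conn F.n x u)).toLinearMap
  have h0 := F.weingarten_normal hx u
  simp only [weingarten] at h0 ⊢
  simpa [h0] using this

/-- Differentiate `g(n, e_a) = 0`. -/
lemma g_conn_e_normal (hx : x ∈ F.U) (a : Fin m) (v : TangentSpace (𝓡 (m + 1)) x) :
    G.g x (G.conn (F.e a) x v) (F.n x) = -F.weingarten x v (F.e a x) := by
  have h := G.conn_metric x F.n (F.e a) v (F.n_smooth.diffAt F.isOpen_U hx)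
    ((F.e_smooth a).diffAt F.isOpen_U hx)
  rw [mvfderiv_congr_of_eqOn F.isOpen_U hx fun y hy ↦ F.e_tangent y hy a, mvfderiv_const,
    G.g_symm x (F.n x)] at h
  simp only [zero_apply] at h
  rw [weingarten]
  linarith

lemma g_normal_conn_e (hx : x ∈ F.U) (a : Fin m) (v : TangentSpace (𝓡 (m + 1)) x) :
    G.g x (F.n x) (G.conn (F.e a) x v) = -F.weingarten x v (F.e a x) := by
  rw [G.g_symm, F.g_conn_e_normal hx]

lemma K_eq (a b : Fin m) : F.K a b x = F.weingarten x (F.e a x) (F.e b x) := rfl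

lemma acc_eq (hx : x ∈ F.U) (b : Fin m) : F.acc b x = F.weingarten x (F.n x) (F.e b x) := by
  simp only [acc, accUp]
  rw [F.sum_h_mul_coframe _ hx, G.g_symm]
  rfl

/-- The normal component of `∇_n e_a` is `-ε a_a`, so `V` is just this derivative reassembled. Thus
`Uterm` collects the torsion terms containing `∇_n e_a`. -/
lemma V_eq (hx : x ∈ F.U) (a : Fin m) : F.V a x = G.nabla F.n (F.e a) x := by
  have h := F.sum_coframe_smul (G.nabla F.n (F.e a)) hx
  rw [RiemannCartan.nabla, F.g_normal_conn_e hx, ← F.acc_eq hx] at h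
  simp only [V, φ]
  rw [RiemannCartan.nabla, h]
  simp

/-- The tangent spaces of the leaves are closed under the Lie bracket. -/
lemma g_normal_mlieBracket (hx : x ∈ F.U) (a b : Fin m) :
    G.g x (F.n x) (mlieBracket (𝓡 (m + 1)) (F.e a) (F.e b) x) = 0 := by
  obtain ⟨W, f, hW, hxW, hWU, hf, hfn⟩ := F.foliated x hx
  have h0 : ∀ c, ∀ y ∈ W, mvfderiv (𝓡 (m + 1)) f y (F.e c y) = 0 := fun c y hy ↦
    ((hfn y hy).2 _).2 (F.e_tangent y (hWU hy) c)
  have hd : ∀ c, MDifferentiableAt (𝓡 (m + 1)) 𝓘(ℝ, ℝ)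
      (fun y ↦ mvfderiv (𝓡 (m + 1)) f y (F.e c y)) x := fun c ↦
    (mdifferentiableAt_const (c := (0 : ℝ))).congr_of_eventuallyEq
      (Filter.eventuallyEq_of_mem (hW.mem_nhds hxW) (h0 c))
  -- The kernel of `df` is the complement of `n`. As `df` kills every `e_c` near `x`, both iterated
  -- derivatives in the commutator formula vanish; `n` is its nonvanishing auxiliary field.
  refine ((hfn x hxW).2 _).1 ?_
  rw [mvfderiv_mlieBracket hW hxW hf ((F.e_smooth a).mono hWU) ((F.e_smooth b).mono hWU)
    (F.n_smooth.mono hWU) (F.n_ne_zero hx) (hd a) (hd b),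
    mvfderiv_congr_of_eqOn hW hxW (h0 a), mvfderiv_congr_of_eqOn hW hxW (h0 b)]
  simp [mvfderiv_const]

/-- The antisymmetric part of the second fundamental form is the normal part of the torsion. -/
lemma tors_e_e_normal (hx : x ∈ F.U) (a b : Fin m) :
    G.tors x (F.e a x) (F.e b x) (F.n x) = -(1 / 2) * (F.K a b x - F.K b a x) := by
  have h := congrArg (fun v ↦ G.g x (F.n x) v) (G.two_smul_S
    ((F.e_smooth a).diffAt F.isOpen_U hx) ((F.e_smooth b).diffAt F.isOpen_U hx))
  simp only [map_sub, map_smul, RiemannCartan.nabla, F.g_normal_conn_e hx,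
    F.g_normal_mlieBracket hx, smul_eq_mul] at h
  have h1 : G.tors x (F.e a x) (F.e b x) (F.n x) = G.g x (F.n x) (G.S (F.e a) (F.e b) x) :=
    G.g_symm x _ _
  rw [h1, K_eq, K_eq]
  linarith

/-- Extends `tors_e_e_normal` by linearity to any tangential second argument; it will be applied to
brackets of frame fields, which are tangential by integrability. -/
lemma tors_tangent_normal (hx : x ∈ F.U) (a : Fin m) (hX : G.g x (F.n x) (X x) = 0) :
    G.tors x (F.e a x) (X x) (F.n x) =
      -(1 / 2) * (F.weingarten x (F.e a x) (X x) - F.weingarten x (X x) (F.e a x)) := by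
  have h1 := F.sum_coframe_mul_tors_middle X hx (F.e a x) (F.n x)
  have h2 := F.sum_coframe_mul_weingarten_left X hx (F.e a x)
  have h3 := F.sum_coframe_mul_weingarten_right X hx (F.e a x)
  simp only [hX, mul_zero, zero_mul, sub_zero] at h1 h2
  rw [← h1, ← h2, ← h3, ← Finset.sum_sub_distrib, Finset.mul_sum]
  refine Finset.sum_congr rfl fun d _ ↦ ?_
  rw [F.tors_e_e_normal hx, K_eq, K_eq]
  ring

lemma sum_hInv_mul_K (a i : Fin m) :
    ∑ j, F.hInv i j x * F.K a j x = F.coframe i (G.nabla (F.e a) F.n) x := by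
  simp only [coframe, K, G.g_symm x (G.nabla (F.e a) F.n x)]

end OrthogonalFoliation

namespace RiemannCartan

variable {m : ℕ} {M : Type*} [TopologicalSpace M]
  [ChartedSpace (EuclideanSpace ℝ (Fin (m + 1))) M] [IsManifold (𝓡 (m + 1)) ∞ M]
  (G : RiemannCartan m M)
  {X Y Z W : ∀ x : M, TangentSpace (𝓡 (m + 1)) x} {x : M}

lemma mlieBracket_eq (hX : VectorFieldDiffAt X x) (hY : VectorFieldDiffAt Y x) :
    mlieBracket (𝓡 (m + 1)) X Y x = G.nabla X Y x - G.nabla Y X x - (2 : ℝ) • G.S X Y x := by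
  rw [G.two_smul_S hX hY]; abel

lemma S_swap : G.S X Y x = -G.S Y X x := by
  simp only [S]
  rw [G.conn.torsion_antisymm, smul_neg]

lemma mvfderiv_S₃_swap (v : TangentSpace (𝓡 (m + 1)) x) :
    mvfderiv (𝓡 (m + 1)) (G.S₃ X Y Z) x v = -mvfderiv (𝓡 (m + 1)) (G.S₃ Y X Z) x v := by
  have : G.S₃ X Y Z = fun y ↦ -G.S₃ Y X Z y := funext fun y ↦ G.tors_swap (X y) (Y y) (Z y)
  rw [this, mvfderiv_fun_neg]
  rfl

end RiemannCartan

/-! ### Components of torsion, their intrinsic derivatives and contractions with `K`. -/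

namespace OrthogonalFoliation

variable {m : ℕ} {M : Type*} [TopologicalSpace M]
  [ChartedSpace (EuclideanSpace ℝ (Fin (m + 1))) M] [IsManifold (𝓡 (m + 1)) ∞ M]
  {G : RiemannCartan m M} (F : OrthogonalFoliation G)
  (X : ∀ x : M, TangentSpace (𝓡 (m + 1)) x) {x : M}

section components

variable (a b c : Fin m)

lemma S_eq : F.S a b c = G.S₃ (F.e a) (F.e b) (F.e c) := rfl

lemma S0_eq : F.S0 a b = G.S₃ F.n (F.e a) (F.e b) := rfl

lemma S_apply : F.S a b c x = G.tors x (F.e a x) (F.e b x) (F.e c x) := rfl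

lemma S0_apply : F.S0 a b x = G.tors x (F.n x) (F.e a x) (F.e b x) := rfl

lemma S00_apply : F.S00 a x = G.tors x (F.e a x) (F.n x) (F.n x) := rfl

lemma diffAt_S0 (hx : x ∈ F.U) :
    MDifferentiableAt (𝓡 (m + 1)) 𝓘(ℝ, ℝ) (F.S0 a b) x :=
  G.diffAt_S₃ F.isOpen_U hx F.n_smooth (F.e_smooth a) (F.e_smooth b)

lemma diffAt_S (hx : x ∈ F.U) :
    MDifferentiableAt (𝓡 (m + 1)) 𝓘(ℝ, ℝ) (F.S a b c) x :=
  G.diffAt_S₃ F.isOpen_U hx (F.e_smooth a) (F.e_smooth b) (F.e_smooth c)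

lemma diffAt_K (hx : x ∈ F.U) :
    MDifferentiableAt (𝓡 (m + 1)) 𝓘(ℝ, ℝ) (F.K a b) x :=
  G.diffAt_g F.isOpen_U hx (G.nabla_smoothOn F.isOpen_U (F.e_smooth a) F.n_smooth) (F.e_smooth b)

end components

lemma D₂_sym {ψ : Fin m → Fin m → M → ℝ}
    (hψ : ∀ a b, MDifferentiableAt (𝓡 (m + 1)) 𝓘(ℝ, ℝ) (ψ a b) x) (a b c : Fin m) :
    F.D₂ (fun b c y ↦ sym (fun i j ↦ ψ i j y) b c) a b c x
      = (F.D₂ ψ a b c x + F.D₂ ψ a c b x) / 2 := by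
  simp only [D₂, sym]
  rw [mvfderiv_half_add (hψ b c) (hψ c b)]
  simp only [mul_div_assoc', mul_add, ← Finset.sum_div, Finset.sum_add_distrib]
  ring

lemma D₂_alt {ψ : Fin m → Fin m → M → ℝ}
    (hψ : ∀ a b, MDifferentiableAt (𝓡 (m + 1)) 𝓘(ℝ, ℝ) (ψ a b) x) (a b c : Fin m) :
    F.D₂ (fun b c y ↦ alt (fun i j ↦ ψ i j y) b c) a b c x
      = (F.D₂ ψ a b c x - F.D₂ ψ a c b x) / 2 := by
  simp only [D₂, alt]
  rw [mvfderiv_half_sub (hψ b c) (hψ c b)]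
  simp only [mul_div_assoc', mul_sub, ← Finset.sum_div, Finset.sum_sub_distrib]
  ring

lemma C_def (a b c : Fin m) : F.C a b c x = F.coframe c (G.nabla (F.e a) (F.e b)) x := rfl

/-- The normal part of `∇_a e_b` contributes nothing since `S(n, n) = 0`; that of `∇_a e_c` leaves
the `ε` term. -/
lemma D₂_S0 (hx : x ∈ F.U) (a b c : Fin m) :
    F.D₂ F.S0 a b c x = mvfderiv (𝓡 (m + 1)) (G.S₃ F.n (F.e b) (F.e c)) x (F.e a x)
      - G.tors x (F.n x) (G.nabla (F.e a) (F.e b) x) (F.e c x)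
      - G.tors x (F.n x) (F.e b x) (G.nabla (F.e a) (F.e c) x)
      + F.ε * F.S00 b x * F.K a c x := by
  simp only [D₂, C_def, S0_apply]
  rw [F.sum_coframe_mul_tors_middle _ hx, F.sum_coframe_mul_tors_right _ hx, RiemannCartan.nabla,
    RiemannCartan.nabla, F.g_normal_conn_e hx, F.g_normal_conn_e hx, G.tors_self, S00_apply,
    G.tors_swap (F.e b x), K_eq, S0_eq]
  ring

/-- Only the first slot leaves a normal correction, because `g(∇_u n, n) = 0`. -/
lemma D₂_K (hx : x ∈ F.U) (a b c : Fin m) :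
    F.D₂ F.K a b c x = mvfderiv (𝓡 (m + 1)) (F.K b c) x (F.e a x)
      - F.weingarten x (G.nabla (F.e a) (F.e b) x) (F.e c x)
      - F.weingarten x (F.e b x) (G.nabla (F.e a) (F.e c) x)
      - F.ε * F.K a b x * F.acc c x := by
  simp only [D₂, C_def, F.K_eq (x := x)]
  rw [F.sum_coframe_mul_weingarten_left _ hx, F.sum_coframe_mul_weingarten_right _ hx,
    RiemannCartan.nabla, F.g_normal_conn_e hx, F.acc_eq hx]
  ring

lemma mvfderiv_S₃_e_e_normal (hx : x ∈ F.U) (a b : Fin m) (v : TangentSpace (𝓡 (m + 1)) x) :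
    mvfderiv (𝓡 (m + 1)) (G.S₃ (F.e a) (F.e b) F.n) x v =
      -(1 / 2) * (mvfderiv (𝓡 (m + 1)) (F.K a b) x v - mvfderiv (𝓡 (m + 1)) (F.K b a) x v) := by
  have h : ∀ y ∈ F.U, G.S₃ (F.e a) (F.e b) F.n y = (F.K b a y - F.K a b y) / 2 := fun y hy ↦
    (F.tors_e_e_normal hy a b).trans (by ring)
  rw [mvfderiv_congr_of_eqOn F.isOpen_U hx h,
    mvfderiv_half_sub (F.diffAt_K _ _ hx) (F.diffAt_K _ _ hx)]
  ring

lemma sum_S0_mul_SUp (hx : x ∈ F.U) (a b c : Fin m) :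
    ∑ i, F.S0 i a x * F.SUp b c i x = G.tors x (F.n x) (G.S (F.e b) (F.e c) x) (F.e a x) := by
  simp only [S0_apply, SUp, mul_comm (G.tors x _ _ _)]
  rw [F.sum_coframe_mul_tors_middle _ hx, G.tors_self]
  ring

/-- After antisymmetrization over `a`, `b`, `c` the acceleration term cancels the one in `D₂_K`, so
none survives in the final identity. -/
lemma sum_SUp_mul_K (hx : x ∈ F.U) (a b c : Fin m) :
    ∑ i, F.SUp a b i x * F.K i c x = F.weingarten x (G.S (F.e a) (F.e b) x) (F.e c x)
      + F.ε * (1 / 2 * (F.K a b x - F.K b a x)) * F.acc c x := by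
  have h : G.g x (F.n x) (G.S (F.e a) (F.e b) x) = _ :=
    (G.g_symm x _ _).trans (F.tors_e_e_normal hx a b)
  simp only [SUp, F.K_eq _ c]
  rw [F.sum_coframe_mul_weingarten_left _ hx, h, F.acc_eq hx]
  ring

/-- `K_c{}^i e_i` is all of `∇_c n`, which has no normal part. -/
lemma sum_tors_mul_K (hx : x ∈ F.U) (v w : TangentSpace (𝓡 (m + 1)) x) (c : Fin m) :
    ∑ i, G.tors x (F.e i x) v w * ∑ j, F.hInv i j x * F.K c j x =
      G.tors x (G.nabla (F.e c) F.n x) v w := by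
  simp only [sum_hInv_mul_K, mul_comm (G.tors x _ _ _)]
  rw [F.sum_coframe_mul_tors_left _ hx, G.g_symm x (F.n x)]
  have : G.g x (G.nabla (F.e c) F.n x) (F.n x) = 0 := F.weingarten_normal hx _
  rw [this]
  ring

lemma sum_alt_S_mul_K (hx : x ∈ F.U) (a b c : Fin m) :
    ∑ i, alt (fun a b ↦ F.S i a b x) a b * ∑ j, F.hInv i j x * F.K c j x =
      alt (fun a b ↦ G.tors x (G.nabla (F.e c) F.n x) (F.e a x) (F.e b x)) a b := by
  simp only [alt, div_mul_eq_mul_div, sub_mul, ← Finset.sum_div, Finset.sum_sub_distrib, S_apply,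
    F.sum_tors_mul_K hx]

lemma sum_sym_S_mul_K (hx : x ∈ F.U) (a b c : Fin m) :
    ∑ i, sym (fun a b ↦ F.S i a b x) a b * ∑ j, F.hInv i j x * F.K c j x =
      sym (fun a b ↦ G.tors x (G.nabla (F.e c) F.n x) (F.e a x) (F.e b x)) a b := by
  simp only [sym, div_mul_eq_mul_div, add_mul, ← Finset.sum_div, Finset.sum_add_distrib, S_apply,
    F.sum_tors_mul_K hx]

/-! ### The curvature component with two normal slots. -/

theorem R_e_n_e_n (hx : x ∈ F.U) (a c : Fin m) :
    G.R (F.e a) F.n (F.e c) F.n x =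
      F.D₁ F.acc a c x
        - ∑ d, F.K a d x * ∑ i, F.hInv d i x * F.K i c x
        - F.dot (F.K a c) x
        - F.ε * F.acc a x * F.acc c x
        + ∑ d, F.K a d x * F.φ d c x
        + ∑ d, F.K d c x * F.φ d a x
        + 2 * ∑ d, F.coframe d (G.S (F.e a) F.n) x * F.K d c x
        + 2 * F.ε * F.S00 a x * F.acc c x := by
  have hn := F.n_smooth
  have he := F.e_smooth
  have hd1 : mvfderiv (𝓡 (m + 1)) (fun y ↦ G.g y (G.nabla (F.e a) (F.e c) y) (F.n y)) x (F.n x)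
      = -F.dot (F.K a c) x := by
    have h : ∀ y ∈ F.U, G.g y (G.nabla (F.e a) (F.e c) y) (F.n y) = -F.K a c y := fun y hy ↦
      F.g_conn_e_normal hy c _
    rw [mvfderiv_congr_of_eqOn F.isOpen_U hx h, mvfderiv_fun_neg]
    rfl
  have hd2 : mvfderiv (𝓡 (m + 1)) (fun y ↦ G.g y (G.nabla F.n (F.e c) y) (F.n y)) x (F.e a x)
      = -mvfderiv (𝓡 (m + 1)) (F.acc c) x (F.e a x) := by
    have h : ∀ y ∈ F.U, G.g y (G.nabla F.n (F.e c) y) (F.n y) = -F.acc c y := fun y hy ↦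
      (F.g_conn_e_normal hy c _).trans (by rw [F.acc_eq hy])
    rw [mvfderiv_congr_of_eqOn F.isOpen_U hx h, mvfderiv_fun_neg]
    rfl
  have s1 : ∑ d, F.C a c d x * F.acc d x
      = G.g x (G.nabla (F.e a) (F.e c) x) (G.nabla F.n F.n x) := by
    simp only [C_def, F.acc_eq hx]
    rw [F.sum_coframe_mul_weingarten_right _ hx, weingarten, G.g_symm]
    rfl
  have s2 : ∑ d, F.K a d x * ∑ i, F.hInv d i x * F.K i c x
      = F.weingarten x (G.nabla (F.e a) F.n x) (F.e c x) := by
    have h0 : G.g x (F.n x) (G.nabla (F.e a) F.n x) = 0 :=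
      (G.g_symm x _ _).trans (F.weingarten_normal hx _)
    have h1 := F.sum_coframe_mul_weingarten_left (G.nabla (F.e a) F.n) hx (F.e c x)
    rw [h0, mul_zero, zero_mul, sub_zero] at h1
    rw [← h1]
    simp only [← F.sum_hInv_mul_K, Finset.mul_sum, Finset.sum_mul]
    rw [Finset.sum_comm]
    refine Finset.sum_congr rfl fun i _ ↦ Finset.sum_congr rfl fun d _ ↦ ?_
    rw [F.hInv_symm d i, F.K_eq i c]
    ring
  have s3 : ∑ d, F.K a d x * F.φ d c x
      = G.g x (G.nabla F.n (F.e c) x) (G.nabla (F.e a) F.n x) := by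
    simp only [φ, F.K_eq, mul_comm (F.weingarten _ _ _)]
    rw [F.sum_coframe_mul_weingarten_right _ hx, weingarten, G.g_symm]
    rfl
  -- The normal part of `∇_n e_a` accounts for the term `-ε a_a a_c` of the claim; likewise `s5` for
  -- `2ε S_{a00} a_c`.
  have s4 : ∑ d, F.K d c x * F.φ d a x = F.weingarten x (G.nabla F.n (F.e a) x) (F.e c x)
      + F.ε * F.acc a x * F.acc c x := by
    simp only [φ, F.K_eq, mul_comm (F.weingarten _ _ _)]
    rw [F.sum_coframe_mul_weingarten_left _ hx, RiemannCartan.nabla, F.g_normal_conn_e hx,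
      F.acc_eq hx, F.acc_eq hx]
    ring
  have s5 : ∑ d, F.coframe d (G.S (F.e a) F.n) x * F.K d c x
      = F.weingarten x (G.S (F.e a) F.n x) (F.e c x) - F.ε * F.S00 a x * F.acc c x := by
    have h : G.g x (F.n x) (G.S (F.e a) F.n x) = F.S00 a x := G.g_symm x _ _
    simp only [F.K_eq]
    rw [F.sum_coframe_mul_weingarten_left _ hx, h, F.acc_eq hx]
  rw [G.R_eq F.isOpen_U hx (he a) hn (he c) hn, hd1, hd2, D₁, s1, s2, s3, s4, s5,
    F.g_conn_e_normal hx,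
    G.mlieBracket_eq ((he a).diffAt F.isOpen_U hx) (hn.diffAt F.isOpen_U hx),
    weingarten_sub_left, weingarten_sub_left, weingarten_smul_left]
  ring

end OrthogonalFoliation

/-! ### The defect of pair symmetry. -/

namespace OrthogonalFoliation

variable {m : ℕ} {M : Type*} [TopologicalSpace M]
  [ChartedSpace (EuclideanSpace ℝ (Fin (m + 1))) M] [IsManifold (𝓡 (m + 1)) ∞ M]
  {G : RiemannCartan m M} (F : OrthogonalFoliation G) {x : M}

theorem half_R_sub_R (hx : x ∈ F.U) (a b c : Fin m) :
      1 / 2 * (G.R (F.e c) F.n (F.e a) (F.e b) x - G.R (F.e a) (F.e b) (F.e c) F.n x) =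
        F.D₂ (fun b c y ↦ sym (fun i j ↦ F.S0 i j y) b c) a b c x
        - F.D₂ (fun a c y ↦ sym (fun i j ↦ F.S0 i j y) a c) b a c x
        + F.D₂ (fun b a y ↦ alt (fun i j ↦ F.S0 i j y) b a) c b a x
        - 1 / 2 * F.dot (F.S a b c) x
        + F.dot (fun y ↦ alt (fun a b ↦ F.S c a b y) a b) x
        - 3 / 2 * alt₃ (fun a b c ↦ F.D₂ F.K a b c x) a b c
        - 2 * sym (fun b c ↦ G.S₃ (G.S F.n (F.e a)) (F.e b) (F.e c) x) b c
        + 2 * sym (fun a c ↦ G.S₃ (G.S F.n (F.e b)) (F.e a) (F.e c) x) a c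
        - ∑ i, F.S0 i a x * F.SUp b c i x
        - 2 * alt (fun a b ↦ G.S₃ (G.S (F.e c) F.n) (F.e a) (F.e b) x) a b
        - 2 * sym (fun b c ↦ ∑ i, F.S0 i b x * F.SUp c a i x) b c
        - 3 / 2 * alt₃ (fun a b c ↦ ∑ i, F.SUp a b i x * F.K i c x) a b c
        + ∑ i, alt (fun a b ↦ F.S i a b x) a b * ∑ j, F.hInv i j x * F.K c j x
        - ∑ i, sym (fun b c ↦ F.S i b c x) b c * ∑ j, F.hInv i j x * F.K a j x
        + ∑ i, sym (fun a c ↦ F.S i a c x) a c * ∑ j, F.hInv i j x * F.K b j x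
        + F.ε * F.S00 a x * sym (fun b c ↦ F.K b c x) b c
        - F.ε * alt (fun b c ↦ F.S00 b x * F.K c a x) b c
        - F.ε * sym (fun b c ↦ F.K a b x * F.S00 c x) b c
        + F.Uterm a b c x := by
  have hU := F.isOpen_U
  have hn := F.n_smooth
  have he := F.e_smooth
  have hn0 := F.n_ne_zero hx
  have he0 := F.e_ne_zero hx
  have hp := G.R_pair_swap hU hx (he c) hn (he a) (he b) (he0 c) hn0 (he0 a) (he0 b)
  rw [G.bianchi hU hx (he c) hn (he a) (he b), G.bianchi hU hx (he b) (he c) hn (he a),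
    G.bianchi hU hx hn (he a) (he b) (he c), G.bianchi hU hx (he a) (he b) (he c) hn,
    -- In the Bianchi sum with free slot `n`, the torsion terms with a bracket are turned into
    -- `K`-type terms before the brackets are expanded, since the individual summands of a bracket
    -- need not be tangential.
    F.tors_tangent_normal _ hx a (F.g_normal_mlieBracket hx b c),
    F.tors_tangent_normal _ hx b (F.g_normal_mlieBracket hx c a),
    F.tors_tangent_normal _ hx c (F.g_normal_mlieBracket hx a b)] at hp
  have bee : ∀ i j, mlieBracket (𝓡 (m + 1)) (F.e i) (F.e j) x
      = G.nabla (F.e i) (F.e j) x - G.nabla (F.e j) (F.e i) x - (2 : ℝ) • G.S (F.e i) (F.e j) x :=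
    fun i j ↦ G.mlieBracket_eq ((he i).diffAt hU hx) ((he j).diffAt hU hx)
  have ben : ∀ i, mlieBracket (𝓡 (m + 1)) (F.e i) F.n x
      = G.nabla (F.e i) F.n x - G.nabla F.n (F.e i) x - (2 : ℝ) • G.S (F.e i) F.n x :=
    fun i ↦ G.mlieBracket_eq ((he i).diffAt hU hx) (hn.diffAt hU hx)
  have bne : ∀ i, mlieBracket (𝓡 (m + 1)) F.n (F.e i) x
      = G.nabla F.n (F.e i) x - G.nabla (F.e i) F.n x - (2 : ℝ) • G.S F.n (F.e i) x :=
    fun i ↦ G.mlieBracket_eq (hn.diffAt hU hx) ((he i).diffAt hU hx)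
  -- These and the following swaps give a normal form: `n` and the nested derivatives or torsions go
  -- first, and frame pairs take the cyclic orientation `ab`, `bc`, `ca`. The swaps of two frame
  -- fields are used only at fixed index pairs, as the general rule would rewrite forever.
  have sen : ∀ i, G.S (F.e i) F.n x = (-1 : ℝ) • G.S F.n (F.e i) x := fun i ↦ by
    rw [G.S_swap, neg_one_smul]
  have see : ∀ i j, G.S (F.e i) (F.e j) x = (-1 : ℝ) • G.S (F.e j) (F.e i) x := fun i j ↦ by
    rw [G.S_swap, neg_one_smul]
  simp only [bee, ben, bne, sen, see a c,
    RiemannCartan.tors_sub_middle, RiemannCartan.tors_smul_middle,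
    weingarten_sub_left, weingarten_sub_right, weingarten_smul_left, weingarten_smul_right,
    mvfderiv_S₃_e_e_normal F hx] at hp
  have tdn : ∀ i j (v : TangentSpace (𝓡 (m + 1)) x),
      mvfderiv (𝓡 (m + 1)) (G.S₃ (F.e i) F.n (F.e j)) x v
        = -mvfderiv (𝓡 (m + 1)) (G.S₃ F.n (F.e i) (F.e j)) x v := fun i j v ↦ G.mvfderiv_S₃_swap v
  have tde : ∀ i j k (v : TangentSpace (𝓡 (m + 1)) x),
      mvfderiv (𝓡 (m + 1)) (G.S₃ (F.e i) (F.e j) (F.e k)) x v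
        = -mvfderiv (𝓡 (m + 1)) (G.S₃ (F.e j) (F.e i) (F.e k)) x v :=
    fun i j k v ↦ G.mvfderiv_S₃_swap v
  have ten : ∀ i w, G.tors x (F.e i x) (F.n x) w = -G.tors x (F.n x) (F.e i x) w :=
    fun i w ↦ G.tors_swap ..
  have tee : ∀ i j w, G.tors x (F.e i x) (F.e j x) w = -G.tors x (F.e j x) (F.e i x) w :=
    fun i j w ↦ G.tors_swap ..
  have tea : ∀ i X Y w, G.tors x (F.e i x) (G.nabla X Y x) w =
      -G.tors x (G.nabla X Y x) (F.e i x) w := fun i X Y w ↦ G.tors_swap ..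
  have tes : ∀ i X Y w, G.tors x (F.e i x) (G.S X Y x) w =
      -G.tors x (G.S X Y x) (F.e i x) w := fun i X Y w ↦ G.tors_swap ..
  -- By symmetry of `g`, the same scalar arises as a `K`-type term and as torsion with `∇_i n` in
  -- its last slot; one form is chosen.
  have hws : ∀ i j k, F.weingarten x (F.e i x) (G.S (F.e j) (F.e k) x) =
      G.tors x (F.e j x) (F.e k x) (G.nabla (F.e i) F.n x) := fun i j k ↦ G.g_symm ..
  have S₃_apply : ∀ X Y Z, G.S₃ X Y Z x = G.tors x (X x) (Y x) (Z x) := fun _ _ _ ↦ rfl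
  have hS0 := fun i j ↦ F.diffAt_S0 i j hx
  have hdS : F.dot (fun y ↦ alt (fun a b ↦ F.S c a b y) a b) x =
      (F.dot (F.S c a b) x - F.dot (F.S c b a) x) / 2 :=
    mvfderiv_half_sub (F.diffAt_S c a b hx) (F.diffAt_S c b a hx) _
  rw [F.D₂_sym hS0, F.D₂_sym hS0, F.D₂_alt hS0, hdS]
  simp only [F.sum_alt_S_mul_K hx, F.sum_sym_S_mul_K hx, F.sum_S0_mul_SUp hx,
    F.sum_SUp_mul_K hx, F.D₂_S0 hx, F.D₂_K hx]
  simp only [Uterm, F.V_eq hx, alt, sym, alt₃, S00_apply, S₃_apply, dot, S_eq, F.K_eq (x := x),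
    F.acc_eq hx, sen, see b a, see c b, see a c, RiemannCartan.tors_smul_left,
    RiemannCartan.tors_smul_middle, weingarten_smul_left]
  simp only [tdn, tde c b, tde a c, ten, tee a c, tea, tes, hws] at hp ⊢
  -- `hp` contains twice the curvature difference, the goal half of it.
  linear_combination 1 / 4 * hp

end OrthogonalFoliation

theorem mainTheorem6 {m : ℕ} {M : Type*} [TopologicalSpace M]
    [ChartedSpace (EuclideanSpace ℝ (Fin (m + 1))) M] [IsManifold (𝓡 (m + 1)) ∞ M]
    (G : RiemannCartan m M) (F : OrthogonalFoliation G) (x : M) (hx : x ∈ F.U) :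
    (∀ a c : Fin m,
      G.R (F.e a) F.n (F.e c) F.n x =
        F.D₁ F.acc a c x
        - ∑ d, F.K a d x * ∑ i, F.hInv d i x * F.K i c x
        - F.dot (F.K a c) x
        - F.ε * F.acc a x * F.acc c x
        + ∑ d, F.K a d x * F.φ d c x
        + ∑ d, F.K d c x * F.φ d a x
        + 2 * ∑ d, F.coframe d (G.S (F.e a) F.n) x * F.K d c x
        + 2 * F.ε * F.S00 a x * F.acc c x) ∧
    (∀ a b c : Fin m,
      1 / 2 * (G.R (F.e c) F.n (F.e a) (F.e b) x - G.R (F.e a) (F.e b) (F.e c) F.n x) =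
        F.D₂ (fun b c y ↦ sym (fun i j ↦ F.S0 i j y) b c) a b c x
        - F.D₂ (fun a c y ↦ sym (fun i j ↦ F.S0 i j y) a c) b a c x
        + F.D₂ (fun b a y ↦ alt (fun i j ↦ F.S0 i j y) b a) c b a x
        - 1 / 2 * F.dot (F.S a b c) x
        + F.dot (fun y ↦ alt (fun a b ↦ F.S c a b y) a b) x
        - 3 / 2 * alt₃ (fun a b c ↦ F.D₂ F.K a b c x) a b c
        - 2 * sym (fun b c ↦ G.S₃ (G.S F.n (F.e a)) (F.e b) (F.e c) x) b c
        + 2 * sym (fun a c ↦ G.S₃ (G.S F.n (F.e b)) (F.e a) (F.e c) x) a c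
        - ∑ i, F.S0 i a x * F.SUp b c i x
        - 2 * alt (fun a b ↦ G.S₃ (G.S (F.e c) F.n) (F.e a) (F.e b) x) a b
        - 2 * sym (fun b c ↦ ∑ i, F.S0 i b x * F.SUp c a i x) b c
        - 3 / 2 * alt₃ (fun a b c ↦ ∑ i, F.SUp a b i x * F.K i c x) a b c
        + ∑ i, alt (fun a b ↦ F.S i a b x) a b * ∑ j, F.hInv i j x * F.K c j x
        - ∑ i, sym (fun b c ↦ F.S i b c x) b c * ∑ j, F.hInv i j x * F.K a j x
        + ∑ i, sym (fun a c ↦ F.S i a c x) a c * ∑ j, F.hInv i j x * F.K b j x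
        + F.ε * F.S00 a x * sym (fun b c ↦ F.K b c x) b c
        - F.ε * alt (fun b c ↦ F.S00 b x * F.K c a x) b c
        - F.ε * sym (fun b c ↦ F.K a b x * F.S00 c x) b c
        + F.Uterm a b c x) :=
  ⟨F.R_e_n_e_n hx, F.half_R_sub_R hx⟩

end
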